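/- Let $(M^m,g)$ and $(N^n,h)$ be smooth Riemannian manifolds (finite-dimensional, Hausdorff, without boundary) and let $\varphi : M \to N$ be a smooth map. Let $\tau(\varphi)=\operatorname{Trace}_g\nabla d\varphi$ be its tension field and $$\tau_2(\varphi)=\operatorname{Trace}_g\big(\nabla^{\varphi}\nabla^{\varphi}-\nabla^{\varphi}_{\nabla^{M}}\big)\tau(\varphi)-\operatorname{Trace}_g R^{N}(d\varphi,\tau(\varphi))\,d\varphi$$ its bitension field, where $R^N(X,Y)Z=\nabla^N_X\nabla^N_YZ-\nabla^N_Y\nabla^N_XZ-\nabla^N_{[X,Y]}Z$ and $\nabla^\varphi$ is the pull-back connection on $\varphi^{-1}TN$. The map $\varphi$ is called harmonic if $\tau(\varphi)=0$ on $M$. For a smooth function $f : M \to (0,\infty)$ it is called $f$-biharmonic if it satisfies the Euler-Lagrange equation of the $f$-bienergy $\tfrac12\int f\,|\tau(\varphi)|^2 v_g$, that is $$\tau_{2,f}(\varphi):=f\,\tau_2(\varphi)+(\Delta f)\,\tau(\varphi)+2\,\nabla^{\varphi}_{\operatorname{grad} f}\,\tau(\varphi)=0\quad\text{on } M,$$ where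 $\Delta$ is the Laplace-Beltrami operator of $g$ (the trace of the Hessian). Then $\varphi$ is harmonic if and only if it is $f$-biharmonic for every smooth function $f : M \to (0,\infty)$. -/

import Mathlib

open scoped Manifold ContDiff

noncomputable section

namespace FBiharmonic

/-- The coordinate space `ℝᵐ`. -/
abbrev Coord (m : ℕ) : Type := EuclideanSpace ℝ (Fin m)

/-- A smooth (`C^∞`) Riemannian metric on the `m`-dimensional manifold `M`. -/
abbrev SmoothMetric (m : ℕ) (M : Type*) [TopologicalSpace M] [ChartedSpace (Coord m) M]
    [IsManifold (𝓡 m) ∞ M] : Type _ :=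
  Bundle.ContMDiffRiemannianMetric (𝓡 m) ∞ (Coord m) (fun p : M => TangentSpace (𝓡 m) p)

/-- The partial derivative `∂u/∂xⁱ` at `x`, for `u` defined near `x` in `ℝᵐ`. -/
def pd {m : ℕ} (i : Fin m) (u : Coord m → ℝ) (x : Coord m) : ℝ :=
  fderiv ℝ u x (EuclideanSpace.single i 1)

section OneManifold

variable {m : ℕ} {M : Type*} [TopologicalSpace M] [ChartedSpace (Coord m) M]
  [IsManifold (𝓡 m) ∞ M]

/-- The coordinate vector `∂/∂xⁱ ∈ T_q M` of the preferred chart around `p`, for `q` in the domain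
of that chart. -/
def coordVec (p q : M) (i : Fin m) : TangentSpace (𝓡 m) q :=
  (trivializationAt (Coord m) (TangentSpace (𝓡 m) : M → Type _) p).symmL ℝ q
    (EuclideanSpace.single i (1 : ℝ))

/-- The `i`-th component of `v ∈ T_q M` with respect to the coordinate vectors `∂/∂xⁱ` of the
preferred chart around `p`, for `q` in the domain of that chart. -/
def comp (p q : M) (v : TangentSpace (𝓡 m) q) (i : Fin m) : ℝ :=
  ((trivializationAt (Coord m) (TangentSpace (𝓡 m) : M → Type _) p).continuousLinearMapAt ℝ q v :
    Coord m) i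

/-- The matrix `(g_ij)` of the metric in the chart around `p`, as a function of the coordinates. -/
def gLow (g : SmoothMetric m M) (p : M) (x : Coord m) : Matrix (Fin m) (Fin m) ℝ :=
  Matrix.of fun i j =>
    g.inner ((extChartAt (𝓡 m) p).symm x)
      (coordVec p ((extChartAt (𝓡 m) p).symm x) i) (coordVec p ((extChartAt (𝓡 m) p).symm x) j)

/-- The inverse matrix `(g^ij)` of the metric in the chart around `p`. -/
def gUp (g : SmoothMetric m M) (p : M) (x : Coord m) : Matrix (Fin m) (Fin m) ℝ :=
  (gLow g p x)⁻¹

/-- The Christoffel symbols `Γᵏ_ij` of the Levi-Civita connection in the chart around `p`: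
`Γᵏ_ij = ½ ∑_l g^kl (∂_i g_jl + ∂_j g_il - ∂_l g_ij)`. -/
def christoffel (g : SmoothMetric m M) (p : M) (k i j : Fin m) (x : Coord m) : ℝ :=
  (1 / 2 : ℝ) * ∑ l, gUp g p x k l *
    (pd i (fun y => gLow g p y j l) x + pd j (fun y => gLow g p y i l) x
      - pd l (fun y => gLow g p y i j) x)

/-- The components `Rᵃ_dbc` of the curvature in the chart around `p`, where
`R(∂_b, ∂_c) ∂_d = ∑_a Rᵃ_dbc ∂_a` and
`Rᵃ_dbc = ∂_b Γᵃ_cd - ∂_c Γᵃ_bd + ∑_e (Γᵃ_be Γᵉ_cd - Γᵃ_ce Γᵉ_bd)`. -/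
def curvCoeff (g : SmoothMetric m M) (p : M) (a b c d : Fin m) (x : Coord m) : ℝ :=
  pd b (christoffel g p a c d) x - pd c (christoffel g p a b d) x
    + ∑ e, (christoffel g p a b e x * christoffel g p e c d x
      - christoffel g p a c e x * christoffel g p e b d x)

/-- The curvature operator `R(X,Y)Z = ∇_X ∇_Y Z - ∇_Y ∇_X Z - ∇_[X,Y] Z` on `T_p M`. -/
def curvature (g : SmoothMetric m M) (p : M) (X Y Z : TangentSpace (𝓡 m) p) :
    TangentSpace (𝓡 m) p :=
  ∑ a, (∑ b, ∑ c, ∑ d, curvCoeff g p a b c d (extChartAt (𝓡 m) p p)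
    * comp p p X b * comp p p Y c * comp p p Z d) • coordVec p p a

/-- The gradient: `grad f = ∑_ij g^ij (∂_j f) ∂_i`. -/
def grad (g : SmoothMetric m M) (f : M → ℝ) (p : M) : TangentSpace (𝓡 m) p :=
  ∑ i, (∑ j, gUp g p (extChartAt (𝓡 m) p p) i j
    * pd j (f ∘ (extChartAt (𝓡 m) p).symm) (extChartAt (𝓡 m) p p)) • coordVec p p i

/-- The Laplace-Beltrami operator (trace of the Hessian):
`Δ f = ∑_ij g^ij (∂_i ∂_j f - ∑_k Γᵏ_ij ∂_k f)`. -/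
def laplacian (g : SmoothMetric m M) (f : M → ℝ) (p : M) : ℝ :=
  ∑ i, ∑ j, gUp g p (extChartAt (𝓡 m) p p) i j *
    (pd i (pd j (f ∘ (extChartAt (𝓡 m) p).symm)) (extChartAt (𝓡 m) p p)
      - ∑ k, christoffel g p k i j (extChartAt (𝓡 m) p p)
        * pd k (f ∘ (extChartAt (𝓡 m) p).symm) (extChartAt (𝓡 m) p p))

end OneManifold

section Maps

variable {m n : ℕ}
  {M : Type*} [TopologicalSpace M] [ChartedSpace (Coord m) M] [IsManifold (𝓡 m) ∞ M]
  {N : Type*} [TopologicalSpace N] [ChartedSpace (Coord n) N] [IsManifold (𝓡 n) ∞ N]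

/-- The `a`-th component `φᵃ` of `φ` in the charts around `p` and `φ p`. -/
def mapComp (φ : M → N) (p : M) (a : Fin n) (x : Coord m) : ℝ :=
  (writtenInExtChartAt (𝓡 m) (𝓡 n) p φ x : Coord n) a

/-- The components `Vᵃ` of a vector field `V` along `φ` (a section of `φ⁻¹TN`) in the charts
around `p` and `φ p`, so that `V = ∑_a Vᵃ (∂_a ∘ φ)` near `p`. -/
def secComp (φ : M → N) (V : ∀ q : M, TangentSpace (𝓡 n) (φ q)) (p : M) (a : Fin n)
    (x : Coord m) : ℝ :=
  comp (φ p) (φ ((extChartAt (𝓡 m) p).symm x)) (V ((extChartAt (𝓡 m) p).symm x)) a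

/-- The pull-back connection `∇^φ` in the charts around `p` and `φ p`: for a vector field along `φ`
with components `Wᵃ`, the components of its covariant derivative in the direction `∂_i` are
`∂_i Wᵃ + ∑_bc Γᵃ_bc(φ) (∂_i φᵇ) Wᶜ`. -/
def covPd (h : SmoothMetric n N) (φ : M → N) (p : M) (i : Fin m)
    (W : Fin n → Coord m → ℝ) (a : Fin n) (x : Coord m) : ℝ :=
  pd i (W a) x + ∑ b, ∑ c,
    christoffel h (φ p) a b c (writtenInExtChartAt (𝓡 m) (𝓡 n) p φ x)
      * pd i (mapComp φ p b) x * W c x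

/-- The tension field `τ(φ) = Trace_g ∇dφ`; in the charts around `p` and `φ p` the components of
`∇dφ(∂_i, ∂_j)` are those of `∇^φ_{∂_i} (dφ ∂_j) - dφ (∇^M_{∂_i} ∂_j)`. -/
def tension (g : SmoothMetric m M) (h : SmoothMetric n N) (φ : M → N) (p : M) :
    TangentSpace (𝓡 n) (φ p) :=
  ∑ a, (∑ i, ∑ j, gUp g p (extChartAt (𝓡 m) p p) i j *
    (covPd h φ p i (fun b => pd j (mapComp φ p b)) a (extChartAt (𝓡 m) p p)
      - ∑ k, christoffel g p k i j (extChartAt (𝓡 m) p p)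
        * pd k (mapComp φ p a) (extChartAt (𝓡 m) p p))) • coordVec (φ p) (φ p) a

/-- The covariant derivative `∇^φ_X V` at `p` of a vector field `V` along `φ`, for `X ∈ T_p M`. -/
def covDeriv (h : SmoothMetric n N) (φ : M → N) (V : ∀ q : M, TangentSpace (𝓡 n) (φ q))
    (p : M) (X : TangentSpace (𝓡 m) p) : TangentSpace (𝓡 n) (φ p) :=
  ∑ a, (∑ i, comp p p X i * covPd h φ p i (secComp φ V p) a (extChartAt (𝓡 m) p p))
    • coordVec (φ p) (φ p) a

/-- The rough Laplacian `Trace_g (∇^φ ∇^φ - ∇^φ_{∇^M}) V` of a vector field `V` along `φ`. -/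
def roughLaplacian (g : SmoothMetric m M) (h : SmoothMetric n N) (φ : M → N)
    (V : ∀ q : M, TangentSpace (𝓡 n) (φ q)) (p : M) : TangentSpace (𝓡 n) (φ p) :=
  ∑ a, (∑ i, ∑ j, gUp g p (extChartAt (𝓡 m) p p) i j *
    (covPd h φ p i (fun b => covPd h φ p j (secComp φ V p) b) a (extChartAt (𝓡 m) p p)
      - ∑ k, christoffel g p k i j (extChartAt (𝓡 m) p p)
        * covPd h φ p k (secComp φ V p) a (extChartAt (𝓡 m) p p))) • coordVec (φ p) (φ p) a

/-- The trace `Trace_g R^N(dφ, V) dφ = ∑_ij g^ij R^N(dφ ∂_i, V) dφ ∂_j`. -/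
def curvatureTrace (g : SmoothMetric m M) (h : SmoothMetric n N) (φ : M → N)
    (V : ∀ q : M, TangentSpace (𝓡 n) (φ q)) (p : M) : TangentSpace (𝓡 n) (φ p) :=
  ∑ i, ∑ j, gUp g p (extChartAt (𝓡 m) p p) i j •
    curvature h (φ p) (mfderiv (𝓡 m) (𝓡 n) φ p (coordVec p p i)) (V p)
      (mfderiv (𝓡 m) (𝓡 n) φ p (coordVec p p j))

/-- The bitension field
`τ₂(φ) = Trace_g (∇^φ ∇^φ - ∇^φ_{∇^M}) τ(φ) - Trace_g R^N(dφ, τ(φ)) dφ`. -/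
def bitension (g : SmoothMetric m M) (h : SmoothMetric n N) (φ : M → N) (p : M) :
    TangentSpace (𝓡 n) (φ p) :=
  roughLaplacian g h φ (tension g h φ) p - curvatureTrace g h φ (tension g h φ) p

/-- The `f`-bitension field `τ_{2,f}(φ) = f τ₂(φ) + (Δ f) τ(φ) + 2 ∇^φ_{grad f} τ(φ)`. -/
def fBitension (g : SmoothMetric m M) (h : SmoothMetric n N) (f : M → ℝ) (φ : M → N) (p : M) :
    TangentSpace (𝓡 n) (φ p) :=
  f p • bitension g h φ p + laplacian g f p • tension g h φ p
    + (2 : ℝ) • covDeriv h φ (tension g h φ) p (grad g f p)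

/-- `φ` is harmonic: its tension field vanishes identically. -/
def IsHarmonic (g : SmoothMetric m M) (h : SmoothMetric n N) (φ : M → N) : Prop :=
  ∀ p : M, tension g h φ p = 0

/-- `φ` is `f`-biharmonic: the Euler-Lagrange equation `τ_{2,f}(φ) = 0` of the `f`-bienergy
`½ ∫ f |τ(φ)|²` holds on all of `M`. -/
def IsFBiharmonic (g : SmoothMetric m M) (h : SmoothMetric n N) (f : M → ℝ) (φ : M → N) : Prop :=
  ∀ p : M, fBitension g h f φ p = 0

end Maps

end FBiharmonic

end

open scoped Topology

namespace FBiharmonic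

section Derivatives

variable {m : ℕ}

/-! If `τ(φ)` vanishes identically, so does every term of `τ_{2,f}(φ)`, since each is linear in the
section `τ(φ)` and its derivatives. Conversely, `f = 1` gives `τ₂(φ) = 0`, so every positive smooth
`f` satisfies `(Δf) τ + 2 ∇_{grad f} τ = 0`. Given `p`, take `f` equal to `1 + |x - x₀|²` in a chart
near `p` (`exists_smooth_pos_eventuallyEq`). The gradient vanishes at `p`, while `Δf(p)` is twice
the trace of `(g^ij)` (`laplacian_of_eventuallyEq`), which is positive (`gUp_trace_pos`). Hence
`τ(p) = 0`. -/

lemma pd_congr {i : Fin m} {u v : Coord m → ℝ} {x : Coord m} (huv : u =ᶠ[𝓝 x] v) :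
    pd i u x = pd i v x := by
  rw [pd, pd, huv.fderiv_eq]

@[simp] lemma pd_const (i : Fin m) (c : ℝ) (x : Coord m) : pd i (fun _ => c) x = 0 := by
  simp [pd]

lemma pd_coord (i j : Fin m) (c : ℝ) (x : Coord m) :
    pd i (fun y : Coord m => 2 * (y j - c)) x = if j = i then 2 else 0 := by
  have hd : HasFDerivAt (fun y : Coord m => 2 * (y j - c))
      ((2 : ℝ) • (EuclideanSpace.proj j : Coord m →L[ℝ] ℝ)) x :=
    (((EuclideanSpace.proj j : Coord m →L[ℝ] ℝ).hasFDerivAt).sub_const c).const_mul 2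
  rw [pd, hd.fderiv]
  simp

lemma pd_one_add_norm_sq (j : Fin m) (x₀ x : Coord m) :
    pd j (fun y : Coord m => 1 + ‖y - x₀‖ ^ 2) x = 2 * (x j - x₀ j) := by
  have hd : HasFDerivAt (fun y : Coord m => 1 + ‖y - x₀‖ ^ 2) _ x :=
    (((hasFDerivAt_id x).sub_const x₀).norm_sq).const_add 1
  rw [pd, hd.fderiv]
  simp [EuclideanSpace.inner_single_right]

end Derivatives

section OneManifold

variable {m : ℕ} {M : Type*} [TopologicalSpace M] [ChartedSpace (Coord m) M]
  [IsManifold (𝓡 m) ∞ M]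

/-- The quadratic form at `v` is `g(w, w)` for `w = ∑ vᵢ ∂ᵢ`, and `w ≠ 0` because the trivialization
inverts `v ↦ w` over the chart domain. -/
lemma gLow_posDef (g : SmoothMetric m M) (p : M) {x : Coord m}
    (hx : x ∈ (extChartAt (𝓡 m) p).target) : (gLow g p x).PosDef := by
  set q := (extChartAt (𝓡 m) p).symm x with hq
  have hqb : q ∈ (trivializationAt (Coord m) (TangentSpace (𝓡 m) : M → Type _) p).baseSet := by
    rw [TangentBundle.trivializationAt_baseSet, ← extChartAt_source (𝓡 m)]
    exact (extChartAt (𝓡 m) p).map_target hx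
  refine Matrix.PosDef.of_dotProduct_mulVec_pos ?_ ?_
  · ext i j
    exact g.symm q _ _
  · intro v hv
    let w : TangentSpace (𝓡 m) q := ∑ i, v i • coordVec p q i
    have hw : w = (trivializationAt (Coord m) (TangentSpace (𝓡 m) : M → Type _) p).symmL ℝ q
        (WithLp.toLp 2 v) := by
      have hv' : WithLp.toLp 2 v = ∑ i, v i • EuclideanSpace.single i (1 : ℝ) := by
        ext k
        simp [Pi.single_apply]
      rw [hv', map_sum]
      simp [w, coordVec]
    have hw0 : w ≠ 0 := by
      intro h0
      apply hv
      have h1 := (trivializationAt (Coord m) (TangentSpace (𝓡 m) : M → Type _)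
        p).continuousLinearMapAt_symmL (R := ℝ) hqb (WithLp.toLp 2 v)
      rw [← hw, h0, map_zero] at h1
      simpa using h1.symm
    have hpos := g.pos q w hw0
    have hsum : g.inner q w w = star v ⬝ᵥ (gLow g p x).mulVec v := by
      simp only [w, map_sum, map_smul, _root_.sum_apply,
        _root_.smul_apply, dotProduct, Matrix.mulVec, gLow, Matrix.of_apply,
        smul_eq_mul, Finset.mul_sum, star_trivial]
      rw [Finset.sum_comm]
      refine Finset.sum_congr rfl fun i _ => Finset.sum_congr rfl fun j _ => ?_
      ring
    rwa [← hsum]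

lemma gUp_trace_pos [NeZero m] (g : SmoothMetric m M) (p : M) {x : Coord m}
    (hx : x ∈ (extChartAt (𝓡 m) p).target) : 0 < ∑ i, gUp g p x i i :=
  (gLow_posDef g p hx).inv.trace_pos

lemma grad_eq_zero (g : SmoothMetric m M) {f : M → ℝ} {p : M}
    (hf : ∀ j, pd j (f ∘ (extChartAt (𝓡 m) p).symm) (extChartAt (𝓡 m) p p) = 0) :
    grad g f p = 0 := by
  simp only [grad, hf, mul_zero, Finset.sum_const_zero, zero_smul]

lemma grad_const (g : SmoothMetric m M) (c : ℝ) (p : M) : grad g (fun _ => c) p = 0 :=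
  grad_eq_zero g fun j => pd_const j c _

lemma laplacian_const (g : SmoothMetric m M) (c : ℝ) (p : M) :
    laplacian g (fun _ => c) p = 0 := by
  have h1 (j : Fin m) : pd j ((fun _ : M => c) ∘ (extChartAt (𝓡 m) p).symm) = fun _ => 0 :=
    funext fun x => pd_const j c x
  simp only [laplacian, h1, pd_const, mul_zero, Finset.sum_const_zero, sub_zero]

/-- Around every point there is a positive smooth function which has a critical point there
and which in the preferred chart is `1 + |x - x₀|²` nearby. -/
lemma exists_smooth_pos_eventuallyEq [T2Space M] (p : M) :
    ∃ f : M → ℝ, ContMDiff (𝓡 m) 𝓘(ℝ, ℝ) ∞ f ∧ (∀ q, 0 < f q) ∧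
      f ∘ (extChartAt (𝓡 m) p).symm =ᶠ[𝓝 (extChartAt (𝓡 m) p p)]
        fun x => 1 + ‖x - extChartAt (𝓡 m) p p‖ ^ 2 := by
  let χ : SmoothBumpFunction (𝓡 m) p := Classical.arbitrary _
  -- Only the squared distance is cut off; the constant 1 stays outside the bump and keeps `f`
  -- positive everywhere.
  refine ⟨fun q => 1 + χ q • ‖extChartAt (𝓡 m) p q - extChartAt (𝓡 m) p p‖ ^ 2, ?_, ?_, ?_⟩
  · refine contMDiff_const.add (χ.contMDiff_smul ?_)
    have h1 : ContDiff ℝ ∞ fun x : Coord m => ‖x - extChartAt (𝓡 m) p p‖ ^ 2 :=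
      (contDiff_id.sub contDiff_const).norm_sq ℝ
    exact h1.contMDiff.comp_contMDiffOn contMDiffOn_extChartAt
  · intro q
    have := χ.nonneg (x := q)
    simp only [smul_eq_mul]
    positivity
  · have h1 : ∀ᶠ x in 𝓝 (extChartAt (𝓡 m) p p), χ ((extChartAt (𝓡 m) p).symm x) = 1 := by
      have hc := continuousAt_extChartAt_symm (I := 𝓡 m) p
      have he := χ.eventuallyEq_one
      rw [ContinuousAt, extChartAt_to_inv] at hc
      exact hc.eventually he
    filter_upwards [h1, extChartAt_target_mem_nhds (I := 𝓡 m) p] with x hx hxt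
    simp only [Function.comp_apply, hx, (extChartAt (𝓡 m) p).right_inv hxt, one_smul]

lemma pd_eq_zero_of_eventuallyEq {u : Coord m → ℝ} {x₀ : Coord m}
    (hu : u =ᶠ[𝓝 x₀] fun x => 1 + ‖x - x₀‖ ^ 2) (j : Fin m) : pd j u x₀ = 0 := by
  rw [pd_congr hu, pd_one_add_norm_sq]
  simp

lemma pd_pd_of_eventuallyEq {u : Coord m → ℝ} {x₀ : Coord m}
    (hu : u =ᶠ[𝓝 x₀] fun x => 1 + ‖x - x₀‖ ^ 2) (i j : Fin m) :
    pd i (pd j u) x₀ = if j = i then 2 else 0 := by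
  have h1 : pd j u =ᶠ[𝓝 x₀] fun x => 2 * (x j - x₀ j) := by
    -- Differentiating twice requires the first derivatives to agree on a neighbourhood, not just at
    -- `x₀`.
    filter_upwards [hu.eventuallyEq_nhds] with x hx
    rw [pd_congr hx, pd_one_add_norm_sq]
  rw [pd_congr h1, pd_coord]

/-- The Christoffel terms drop out at a critical point, and the coordinate Hessian is twice the
identity. -/
lemma laplacian_of_eventuallyEq (g : SmoothMetric m M) {f : M → ℝ} {p : M}
    (hf : f ∘ (extChartAt (𝓡 m) p).symm =ᶠ[𝓝 (extChartAt (𝓡 m) p p)]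
      fun x => 1 + ‖x - extChartAt (𝓡 m) p p‖ ^ 2) :
    laplacian g f p = 2 * ∑ i, gUp g p (extChartAt (𝓡 m) p p) i i := by
  simp only [laplacian, pd_pd_of_eventuallyEq hf, pd_eq_zero_of_eventuallyEq hf, mul_zero,
    Finset.sum_const_zero, sub_zero, mul_ite, Finset.sum_ite_eq', Finset.mem_univ, if_true,
    ← Finset.sum_mul]
  exact mul_comm _ _

lemma comp_zero (p q : M) (i : Fin m) : comp p q (0 : TangentSpace (𝓡 m) q) i = 0 := by
  simp [comp]

end OneManifold

section ZeroSection

variable {m n : ℕ} {M : Type*} [TopologicalSpace M] [ChartedSpace (Coord m) M]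
  {N : Type*} [TopologicalSpace N] [ChartedSpace (Coord n) N] [IsManifold (𝓡 n) ∞ N]

lemma secComp_zero (φ : M → N) (p : M) :
    secComp (m := m) (n := n) φ (fun _ => 0) p = fun _ _ => 0 := by
  funext a x
  exact comp_zero _ _ a

lemma covPd_zero (h : SmoothMetric n N) (φ : M → N) (p : M) (i : Fin m) :
    covPd (m := m) h φ p i (fun _ _ => 0) = fun _ _ => 0 := by
  funext a x
  simp [covPd]

end ZeroSection

section Maps

variable {m n : ℕ}
  {M : Type*} [TopologicalSpace M] [ChartedSpace (Coord m) M] [IsManifold (𝓡 m) ∞ M]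
  {N : Type*} [TopologicalSpace N] [ChartedSpace (Coord n) N] [IsManifold (𝓡 n) ∞ N]

lemma curvature_zero_middle (h : SmoothMetric n N) (p : N) (X Z : TangentSpace (𝓡 n) p) :
    curvature h p X 0 Z = 0 := by
  simp [curvature, comp_zero]

lemma covDeriv_zero_section (h : SmoothMetric n N) (φ : M → N) (p : M)
    (X : TangentSpace (𝓡 m) p) : covDeriv h φ (fun _ => 0) p X = 0 := by
  simp [covDeriv, secComp_zero, covPd_zero]

lemma covDeriv_zero_direction (h : SmoothMetric n N) (φ : M → N)
    (V : ∀ q : M, TangentSpace (𝓡 n) (φ q)) (p : M) :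
    covDeriv h φ V p (0 : TangentSpace (𝓡 m) p) = 0 := by
  simp [covDeriv, comp_zero]

lemma roughLaplacian_zero (g : SmoothMetric m M) (h : SmoothMetric n N) (φ : M → N) (p : M) :
    roughLaplacian g h φ (fun _ => 0) p = 0 := by
  simp [roughLaplacian, secComp_zero, covPd_zero]

lemma curvatureTrace_zero (g : SmoothMetric m M) (h : SmoothMetric n N) (φ : M → N) (p : M) :
    curvatureTrace g h φ (fun _ => 0) p = 0 := by
  simp [curvatureTrace, curvature_zero_middle]

theorem IsHarmonic.isFBiharmonic {g : SmoothMetric m M} {h : SmoothMetric n N} {φ : M → N}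
    (hφ : IsHarmonic g h φ) (f : M → ℝ) : IsFBiharmonic g h f φ := by
  -- An equality of sections, since the derivatives in `τ_{2,f}` see `τ` near `p` and not only at
  -- `p`.
  have h0 : tension g h φ = fun _ => 0 := funext hφ
  intro p
  rw [fBitension, bitension, h0, roughLaplacian_zero, curvatureTrace_zero, covDeriv_zero_section]
  simp

lemma IsFBiharmonic.bitension_eq_zero {g : SmoothMetric m M} {h : SmoothMetric n N} {φ : M → N}
    (hφ : IsFBiharmonic g h (fun _ => 1) φ) (p : M) : bitension g h φ p = 0 := by
  have h1 := hφ p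
  rw [fBitension, laplacian_const, grad_const, covDeriv_zero_direction] at h1
  simpa using h1

theorem isHarmonic_of_forall_isFBiharmonic [T2Space M] {g : SmoothMetric m M}
    {h : SmoothMetric n N} {φ : M → N}
    (hφ : ∀ f : M → ℝ, ContMDiff (𝓡 m) 𝓘(ℝ, ℝ) ∞ f → (∀ p : M, 0 < f p) →
      IsFBiharmonic g h f φ) : IsHarmonic g h φ := by
  intro p
  -- In dimension 0 the trace of `(g^ij)` is an empty sum, hence not positive, but `τ` is an empty
  -- sum too.
  rcases Nat.eq_zero_or_pos m with rfl | hm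
  · simp [tension]
  have : NeZero m := ⟨hm.ne'⟩
  have hbi : bitension g h φ p = 0 :=
    (hφ (fun _ => 1) contMDiff_const fun _ => one_pos).bitension_eq_zero p
  obtain ⟨f, hf, hfpos, hfeq⟩ := exists_smooth_pos_eventuallyEq (m := m) p
  have h1 := hφ f hf hfpos p
  -- Only `Δf(p) • τ(p) = 0` survives.
  rw [fBitension, hbi, grad_eq_zero g (pd_eq_zero_of_eventuallyEq hfeq),
    covDeriv_zero_direction, smul_zero, smul_zero, zero_add, add_zero, smul_eq_zero,
    laplacian_of_eventuallyEq g hfeq] at h1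
  exact h1.resolve_left
    (mul_pos two_pos (gUp_trace_pos g p (mem_extChartAt_target p))).ne'

end Maps

end FBiharmonic


theorem theorem2p2 {m n : ℕ}
    {M : Type*} [TopologicalSpace M] [T2Space M] [ChartedSpace (EuclideanSpace ℝ (Fin m)) M]
    [IsManifold (𝓡 m) ∞ M]
    {N : Type*} [TopologicalSpace N] [T2Space N] [ChartedSpace (EuclideanSpace ℝ (Fin n)) N]
    [IsManifold (𝓡 n) ∞ N]
    (g : FBiharmonic.SmoothMetric m M) (h : FBiharmonic.SmoothMetric n N)
    (φ : M → N) (hφ : ContMDiff (𝓡 m) (𝓡 n) ∞ φ) :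
    FBiharmonic.IsHarmonic g h φ ↔
      ∀ f : M → ℝ, ContMDiff (𝓡 m) 𝓘(ℝ, ℝ) ∞ f → (∀ p : M, 0 < f p) →
        FBiharmonic.IsFBiharmonic g h f φ := by
  exact ⟨fun hh f _ _ => hh.isFBiharmonic f, FBiharmonic.isHarmonic_of_forall_isFBiharmonic⟩
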